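/- Let $\Sigma$ be a finite alphabet with at least two letters. For strings $u, v \in \Sigma^n$ (indexed from $0$), the correlation of $u$ over $v$ is the binary vector $t \in \{0,1\}^n$ such that, for every $k \in \{0,\ldots,n-1\}$, $t[k] = 1$ if $u[i] = v[j]$ for all $i, j \in \{0,\ldots,n-1\}$ with $i = j + k$, and $t[k] = 0$ otherwise. Let $\delta_n$ be the number of distinct vectors $t \in \{0,1\}^n$ that occur as the correlation of $u$ over $v$ for some $u, v \in \Sigma^n$. Then $$\frac{\ln \delta_n}{\ln^2(n)} \longrightarrow \frac{1}{2\ln 2} \quad \text{as } n \to \infty.$$ -/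

import Mathlib

/-- The correlation of a string `u` of length `n` over a string `v` of length `m`: the binary vector
of length `n` whose entry at `k` is `1` (that is, `true`) exactly when `u[i] = v[j]` for all positions
`i` of `u` and `j` of `v` with `i = j + k`. -/
noncomputable def correlation {α : Type*} {n m : ℕ} (u : Fin n → α) (v : Fin m → α) :
    Fin n → Bool :=
  open Classical in
  fun k => decide (∀ (i : Fin n) (j : Fin m), (i : ℕ) = (j : ℕ) + (k : ℕ) → u i = v j)

/-- The set `Δ_n` of all correlations between two strings of the same length `n`
over the alphabet `α`. -/
def correlationSet (α : Type*) (n : ℕ) : Set (Fin n → Bool) :=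
  {t | ∃ u v : Fin n → α, correlation u v = t}

/-- The number `δ_n` of correlations between two strings of the same length `n`
over the alphabet `α` (the cardinality of a set of binary vectors, hence finite). -/
noncomputable def numCorrelations (α : Type*) (n : ℕ) : ℕ :=
  (correlationSet α n).ncard

/-! A correlation of `u` over `v` is determined by its least compatible shift `k` (with `k = n` for
none) and the periods of the prefix of `v` of length `n - k`. Up to a factor `n + 1`, the upper
bound is therefore a count of period sets.

That count is governed by `F(n) = 2n F(n/2)` (`periodBound`), for which `ln F(n) ≤ ln² n / (2 ln 2)
+ O(ln n)`. Let `q` be the least positive period of a word of length `n`. If `q > n/2`, the other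
periods are read off a prefix of length `n - q ≤ n/2`. If `q ≤ n/2`, one needs a bound for words
with period `q` that is uniform in their length; by Fine and Wilf, lengths below `2q` suffice. The
two bounds are proved together in `encard_periodSets_le_and`.

For the lower bound, autocorrelations suffice. In the words `xₖ₊₁ = xₖ 1^(yₖ) xₖ` with increasing
`yₖ`, the proper nonempty borders are exactly the earlier `xⱼ`, so the correlation reveals every
`yⱼ`. Taking `yᵢ` in `[2^i, 2^(i+1))` for `i < k` gives `2^(0 + ⋯ + (k-1))` correlations, and `k`
may be as large as `log₂ n - log₂ log₂ n - O(1)`. -/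

/-- The periods of the prefix of length `m` of the infinite word `w`;
every `e ≥ m` counts as a period. -/
def periodSet {α : Type*} (w : ℕ → α) (m : ℕ) : Set ℕ :=
  {e | ∀ i, i + e < m → w i = w (i + e)}

/-! ### Periods of words -/

section Periods

variable {α : Type*} {w : ℕ → α} {m p q g e : ℕ}

lemma zero_mem_periodSet : 0 ∈ periodSet w m := fun _ _ => rfl

lemma mem_periodSet_of_le (h : m ≤ e) : e ∈ periodSet w m := fun i hi => by omega

lemma sub_mem_periodSet (hp : p ∈ periodSet w m) (hq : q ∈ periodSet w m) (hqp : q ≤ p)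
    (hm : p + q ≤ m) : p - q ∈ periodSet w m := by
  intro i hi
  rcases le_or_gt q i with h | h
  · have h1 := hq (i - q) (by omega)
    have h2 := hp (i - q) (by omega)
    rw [show i - q + q = i by omega] at h1
    rw [show i - q + p = i + (p - q) by omega] at h2
    rw [← h1, h2]
  · have h1 := hp i (by omega)
    have h2 := hq (i + (p - q)) (by omega)
    rw [show i + (p - q) + q = i + p by omega] at h2
    rw [h1, h2]

/-- The weak form of the theorem of Fine and Wilf. -/
lemma gcd_mem_periodSet (hp : p ∈ periodSet w m) (hq : q ∈ periodSet w m) (hm : p + q ≤ m) :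
    Nat.gcd p q ∈ periodSet w m := by
  induction hs : p + q using Nat.strong_induction_on generalizing p q with
  | _ s ih =>
    rcases Nat.eq_zero_or_pos p with rfl | hp0
    · simpa using hq
    rcases Nat.eq_zero_or_pos q with rfl | hq0
    · simpa using hp
    rcases le_total q p with h | h
    · have := ih (p - q + q) (by omega) (sub_mem_periodSet hp hq h hm) hq (by omega) rfl
      rwa [Nat.gcd_sub_self_left h] at this
    · have := ih (p + (q - p)) (by omega) hp (sub_mem_periodSet hq hp h (by omega)) (by omega) rfl
      rwa [Nat.gcd_sub_self_right h] at this

lemma mul_mem_periodSet (hg : g ∈ periodSet w m) (c : ℕ) : g * c ∈ periodSet w m := by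
  induction c with
  | zero => exact zero_mem_periodSet
  | succ c ih =>
    intro i hi
    rw [Nat.mul_succ] at hi ⊢
    rw [ih i (by omega), hg (i + g * c) (by omega), add_assoc]

/-- The word repeats its first `p` letters, and these already consist of whole blocks of length `g`.
-/
lemma mem_periodSet_of_dvd (hp : p ∈ periodSet w m) (hg : g ∈ periodSet w e) (hgp : g ∣ p)
    (hp0 : 0 < p) (hpe : p ≤ e) : g ∈ periodSet w m := by
  have hgle : g ≤ p := Nat.le_of_dvd hp0 hgp
  intro i
  induction i using Nat.strong_induction_on with
  | _ i ih =>
    intro hi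
    rcases lt_or_ge (i + g) e with h | h
    · exact hg i h
    have h2 := hp (i + g - p) (by omega)
    rw [show i + g - p + p = i + g by omega] at h2
    rcases le_or_gt p i with h1 | h1
    · have h3 := hp (i - p) (by omega)
      rw [show i - p + p = i by omega] at h3
      rw [← h3, ih (i - p) (by omega) (by omega), ← h2]
      congr 1
      omega
    · obtain ⟨c, rfl⟩ := hgp
      have hc : 0 < c := Nat.pos_of_mul_pos_left hp0
      have h4 : g * (c - 1) = g * c - g := by rw [Nat.mul_sub, mul_one]
      have h3 := mul_mem_periodSet hg (c - 1) (i + g - g * c) (by omega)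
      rw [h4, show i + g - g * c + (g * c - g) = i by omega] at h3
      rw [← h2, h3]

lemma add_mem_periodSet_iff (hq : q ∈ periodSet w m) :
    e + q ∈ periodSet w m ↔ e ∈ periodSet w (m - q) := by
  constructor
  · intro h i hi
    rw [h i (by omega), hq (i + e) (by omega), add_assoc]
  · intro h i hi
    rw [h i (by omega), hq (i + e) (by omega), add_assoc]

lemma mem_periodSet_iff_of_le (hq : q ∈ periodSet w m) (hqe : q ≤ e) :
    e ∈ periodSet w m ↔ e - q ∈ periodSet w (m - q) := by
  rw [← add_mem_periodSet_iff hq, Nat.sub_add_cancel hqe]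

/-- For `e < p`, Fine and Wilf turn the periods `e` and `p` into the period `gcd e p`, which is
already visible on the first `p` letters. Hence the shorter prefix determines all periods. -/
lemma periodSet_eq_of_two_mul_le (hp : p ∈ periodSet w m) (hp0 : 0 < p) (hm : 2 * p ≤ m) :
    periodSet w m = {e | if p ≤ e then e - p ∈ periodSet w (m - p)
      else Nat.gcd e p ∈ periodSet w (m - p)} := by
  ext e
  simp only [Set.mem_ofPred_eq]
  split_ifs with h
  · exact mem_periodSet_iff_of_le hp h
  · constructor
    · intro he i hi
      exact gcd_mem_periodSet he hp (by omega) i (by omega)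
    · intro hg
      have := mem_periodSet_of_dvd hp hg (Nat.gcd_dvd_right e p) hp0 (by omega)
      obtain ⟨c, hc⟩ := Nat.gcd_dvd_left e p
      have h2 := mul_mem_periodSet this c
      rwa [← hc] at h2

end Periods

/-! ### Counting period sets -/

/-- The period sets of words of length `m`. -/
def periodSets (α : Type*) (m : ℕ) : Set (Set ℕ) :=
  Set.range fun w : ℕ → α => periodSet w m

/-- The period sets of words of length `m` that have the period `p`. -/
def periodSetsWith (α : Type*) (m p : ℕ) : Set (Set ℕ) :=
  {P ∈ periodSets α m | p ∈ P}

/-- A bound for the number of period sets. -/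
def periodBound : ℕ → ℕ
  | 0 => 1
  | n + 1 => 2 * (n + 1) * periodBound ((n + 1) / 2)

lemma periodBound_of_pos {n : ℕ} (hn : 0 < n) :
    periodBound n = 2 * n * periodBound (n / 2) := by
  obtain ⟨k, rfl⟩ := Nat.exists_eq_succ_of_ne_zero hn.ne'
  rw [Nat.succ_eq_add_one, periodBound]

lemma periodBound_pos (n : ℕ) : 0 < periodBound n := by
  induction n using Nat.strong_induction_on with
  | _ n ih =>
    rcases Nat.eq_zero_or_pos n with rfl | hn
    · simp [periodBound]
    · rw [periodBound_of_pos hn]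
      have := ih (n / 2) (by omega)
      positivity

lemma periodBound_mono : Monotone periodBound := by
  intro a b hab
  induction b using Nat.strong_induction_on generalizing a with
  | _ b ih =>
    rcases Nat.eq_zero_or_pos a with rfl | ha
    · simpa [periodBound] using Nat.succ_le_of_lt (periodBound_pos b)
    · rw [periodBound_of_pos ha, periodBound_of_pos (ha.trans_le hab)]
      exact Nat.mul_le_mul (by omega) (ih (b / 2) (by omega) (by omega))

/-- The members of `S` whose least positive element is `q`. -/
def withLeastPos (S : Set (Set ℕ)) (q : ℕ) : Set (Set ℕ) :=
  {P ∈ S | q ∈ P ∧ ∀ e ∈ P, 0 < e → q ≤ e}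

lemma encard_biUnion_le_mul {ι β : Type*} (s : Finset ι) (f : ι → Set β) (c : ℕ)
    (h : ∀ i ∈ s, (f i).encard ≤ c) : (⋃ i ∈ s, f i).encard ≤ ((s.card * c : ℕ) : ℕ∞) := by
  classical
  induction s using Finset.induction_on with
  | empty => simp
  | insert a s ha ih =>
    rw [Finset.set_biUnion_insert, Finset.card_insert_of_notMem ha, add_mul, one_mul, add_comm]
    push_cast
    refine (Set.encard_union_le _ _).trans (add_le_add (h a (by simp)) ?_)
    exact_mod_cast ih fun i hi => h i (by simp [hi])

lemma subset_biUnion_withLeastPos {S : Set (Set ℕ)} {n : ℕ} (hn : 0 < n)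
    (h : ∀ P ∈ S, n ∈ P) : S ⊆ ⋃ q ∈ Finset.Icc 1 n, withLeastPos S q := by
  classical
  intro P hP
  have hex : ∃ q, q ∈ P ∧ 0 < q := ⟨n, h P hP, hn⟩
  simp only [Set.mem_iUnion, Finset.mem_Icc]
  exact ⟨Nat.find hex, ⟨(Nat.find_spec hex).2, Nat.find_min' hex ⟨h P hP, hn⟩⟩, hP,
    (Nat.find_spec hex).1, fun e he he0 => Nat.find_min' hex ⟨he, he0⟩⟩

section Counting

variable {α : Type*} {m p q n : ℕ}

lemma periodSet_eq_of_least {w : ℕ → α} (hq : q ∈ periodSet w m)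
    (hmin : ∀ e ∈ periodSet w m, 0 < e → q ≤ e) :
    periodSet w m = {e | e = 0 ∨ q ≤ e ∧ e - q ∈ periodSet w (m - q)} := by
  ext e
  simp only [Set.mem_ofPred_eq]
  rcases Nat.eq_zero_or_pos e with rfl | he
  · simp [zero_mem_periodSet]
  constructor
  · intro h
    exact Or.inr ⟨hmin e h he, (mem_periodSet_iff_of_le hq (hmin e h he)).1 h⟩
  · rintro (h | ⟨h1, h2⟩)
    · omega
    · exact (mem_periodSet_iff_of_le hq h1).2 h2

lemma encard_withLeastPos_le :
    (withLeastPos (periodSets α m) q).encard ≤ (periodSets α (m - q)).encard := by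
  refine (Set.encard_le_encard ?_).trans
    (Set.encard_image_le (fun Q => {e | e = 0 ∨ q ≤ e ∧ e - q ∈ Q}) (periodSets α (m - q)))
  rintro _ ⟨⟨w, rfl⟩, hq, hmin⟩
  exact ⟨_, ⟨w, rfl⟩, (periodSet_eq_of_least hq hmin).symm⟩

lemma encard_withLeastPos_with_le (hqp : q ≤ p) :
    (withLeastPos (periodSetsWith α m p) q).encard ≤
      (periodSetsWith α (m - q) (p - q)).encard := by
  refine (Set.encard_le_encard ?_).trans
    (Set.encard_image_le (fun Q => {e | e = 0 ∨ q ≤ e ∧ e - q ∈ Q}) _)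
  rintro _ ⟨⟨⟨w, rfl⟩, hp⟩, hq, hmin⟩
  exact ⟨_, ⟨⟨w, rfl⟩, (mem_periodSet_iff_of_le hq hqp).1 hp⟩,
    (periodSet_eq_of_least hq hmin).symm⟩

lemma withLeastPos_mono {S T : Set (Set ℕ)} (h : S ⊆ T) : withLeastPos S q ⊆ withLeastPos T q :=
  fun _ hP => ⟨h hP.1, hP.2⟩

lemma withLeastPos_subset : withLeastPos (periodSets α m) q ⊆ periodSetsWith α m q :=
  fun _ hP => ⟨hP.1, hP.2.1⟩

lemma periodSetsWith_subset : periodSetsWith α m p ⊆ periodSets α m := fun _ hP => hP.1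

lemma encard_periodSetsWith_le_sub (hp0 : 0 < p) (hm : 2 * p ≤ m) :
    (periodSetsWith α m p).encard ≤ (periodSetsWith α (m - p) p).encard := by
  refine (Set.encard_le_encard ?_).trans
    (Set.encard_image_le (fun Q => {e | if p ≤ e then e - p ∈ Q else Nat.gcd e p ∈ Q}) _)
  rintro _ ⟨⟨w, rfl⟩, hp⟩
  exact ⟨_, ⟨⟨w, rfl⟩, fun i hi => hp i (by omega)⟩, (periodSet_eq_of_two_mul_le hp hp0 hm).symm⟩

lemma encard_periodSets_zero_le : (periodSets α 0).encard ≤ 1 := by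
  rw [Set.encard_le_one_iff]
  rintro _ _ ⟨v, rfl⟩ ⟨w, rfl⟩
  ext e
  simp [periodSet]

/-- Both claims split by the least positive period `q`. Each feeds the other: a small `q` calls for
the second claim at `q`, and removing a large period calls for the first at a shorter length. -/
theorem encard_periodSets_le_and (n : ℕ) :
    (periodSets α n).encard ≤ ((n + 1) * periodBound (n / 2) : ℕ) ∧
      (0 < n → ∀ m, (periodSetsWith α m n).encard ≤ (periodBound n : ℕ)) := by
  induction n using Nat.strong_induction_on with
  | _ n ih =>
    rcases Nat.eq_zero_or_pos n with rfl | hn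
    · exact ⟨by simpa [periodBound] using encard_periodSets_zero_le, fun h => absurd h (by simp)⟩
    have hhalf : ∀ {k}, k ≤ n / 2 → (periodBound k : ℕ∞) ≤ periodBound (n / 2) := fun h => by
      exact_mod_cast periodBound_mono h
    have hK : ∀ k ≤ n / 2, (periodSets α k).encard ≤ (periodBound (n / 2) : ℕ) := by
      intro k hk
      refine ((ih k (by omega)).1.trans ?_).trans (hhalf hk)
      rcases Nat.eq_zero_or_pos k with rfl | hk0
      · simp [periodBound]
      · rw [periodBound_of_pos hk0]
        exact_mod_cast Nat.mul_le_mul_right _ (by omega)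
    have hone : (periodSets α n).encard ≤ ((n + 1) * periodBound (n / 2) : ℕ) := by
      refine (Set.encard_le_encard (subset_biUnion_withLeastPos hn ?_)).trans
        ((encard_biUnion_le_mul _ _ (periodBound (n / 2)) ?_).trans ?_)
      · rintro _ ⟨w, rfl⟩
        exact mem_periodSet_of_le le_rfl
      · intro q hq
        rw [Finset.mem_Icc] at hq
        rcases le_or_gt q (n / 2) with h | h
        · exact ((Set.encard_le_encard withLeastPos_subset).trans
            ((ih q (by omega)).2 hq.1 n)).trans (hhalf h)
        · exact encard_withLeastPos_le.trans (hK _ (by omega))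
      · rw [Nat.card_Icc]
        exact_mod_cast Nat.mul_le_mul_right _ (by omega)
    refine ⟨hone, fun _ m => ?_⟩
    induction m using Nat.strong_induction_on with
    | _ m ihm =>
      rcases le_or_gt (2 * n) m with hm | hm
      · exact (encard_periodSetsWith_le_sub hn hm).trans (ihm (m - n) (by omega))
      have hsub : periodSetsWith α m n ⊆
          withLeastPos (periodSets α m) n ∪
            ⋃ q ∈ Finset.Icc 1 (n - 1), withLeastPos (periodSetsWith α m n) q := by
        intro P hP
        have := subset_biUnion_withLeastPos (S := periodSetsWith α m n) hn (fun P hP => hP.2) hP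
        simp only [Set.mem_iUnion, Finset.mem_Icc] at this
        obtain ⟨q, hq, hPq⟩ := this
        rcases eq_or_ne q n with rfl | hne
        · exact Or.inl (withLeastPos_mono periodSetsWith_subset hPq)
        · refine Or.inr ?_
          simp only [Set.mem_iUnion, Finset.mem_Icc]
          exact ⟨q, by omega, hPq⟩
      -- For `q = n` the remaining length `m - n` is below `n` but need not be at most `n / 2`, so
      -- this single case costs as much as all `q < n` together; hence the factor `2` in
      -- `periodBound`.
      have hone' : (withLeastPos (periodSets α m) n).encard ≤ (n * periodBound (n / 2) : ℕ) := by
        refine (encard_withLeastPos_le.trans (ih (m - n) (by omega)).1).trans ?_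
        exact_mod_cast Nat.mul_le_mul (by omega) (periodBound_mono (by omega))
      have htwo : (⋃ q ∈ Finset.Icc 1 (n - 1), withLeastPos (periodSetsWith α m n) q).encard ≤
          (n * periodBound (n / 2) : ℕ) := by
        refine (encard_biUnion_le_mul _ _ (periodBound (n / 2)) ?_).trans ?_
        · intro q hq
          rw [Finset.mem_Icc] at hq
          rcases le_or_gt q (n / 2) with h | h
          · exact ((Set.encard_le_encard ((withLeastPos_mono periodSetsWith_subset).trans
              withLeastPos_subset)).trans ((ih q (by omega)).2 hq.1 m)).trans (hhalf h)
          · exact ((encard_withLeastPos_with_le (by omega)).trans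
              ((ih (n - q) (by omega)).2 (by omega) (m - q))).trans (hhalf (by omega))
        · rw [Nat.card_Icc]
          exact_mod_cast Nat.mul_le_mul_right _ (by omega)
      refine ((Set.encard_le_encard hsub).trans (Set.encard_union_le _ _)).trans
        ((add_le_add hone' htwo).trans ?_)
      rw [periodBound_of_pos hn]
      exact_mod_cast (by rw [← two_mul, mul_assoc])

lemma encard_periodSets_le (n : ℕ) : (periodSets α n).encard ≤ (periodBound n : ℕ) := by
  refine (encard_periodSets_le_and n).1.trans ?_
  rcases Nat.eq_zero_or_pos n with rfl | hn
  · simp [periodBound]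
  · rw [periodBound_of_pos hn]
    exact_mod_cast Nat.mul_le_mul_right _ (by omega)

end Counting

/-! ### Upper bound for the number of correlations -/

theorem numCorrelations_le (α : Type*) [Nonempty α] (n : ℕ) :
    numCorrelations α n ≤ (n + 1) * periodBound n := by
  classical
  let Φ : ℕ → Set ℕ → Fin n → Bool := fun k Q j => decide (k ≤ (j : ℕ) ∧ (j : ℕ) - k ∈ Q)
  have hsub : correlationSet α n ⊆
      ⋃ k ∈ Finset.range (n + 1), Φ k '' periodSets α (n - k) := by
    rintro _ ⟨u, v, rfl⟩
    obtain ⟨a⟩ := ‹Nonempty α›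
    let w : ℕ → α := fun i => if h : i < n then v ⟨i, h⟩ else a
    have hw : ∀ i : Fin n, w i = v i := fun i => by simp [w]
    let O : ℕ → Prop := fun k => ∀ i j : Fin n, (i : ℕ) = j + k → u i = v j
    -- The shift `n` is vacuously compatible, so the zero vector needs no separate case.
    have hO : ∃ k, O k := ⟨n, fun i j h => by omega⟩
    have hkn : Nat.find hO ≤ n := Nat.find_min' hO fun i j h => by omega
    have hk := Nat.find_spec hO
    have hmin : ∀ j, O j → Nat.find hO ≤ j := fun j hj => Nat.find_min' hO hj
    generalize Nat.find hO = k at hkn hk hmin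
    simp only [Set.mem_iUnion, Finset.mem_range]
    refine ⟨k, by omega, _, ⟨w, rfl⟩, ?_⟩
    ext1 j
    simp only [Φ, correlation, decide_eq_decide]
    constructor
    · rintro ⟨hkj, hper⟩ i l hil
      have h1 := hper l (by omega)
      have h2 := hk i ⟨l + (j - k), by omega⟩ (by simp; omega)
      rw [h2, ← hw l, h1]
      exact (hw ⟨l + (j - k), by omega⟩).symm
    · intro hj
      have hkj := hmin j hj
      refine ⟨hkj, fun i hi => ?_⟩
      have h1 := hj ⟨i + j, by omega⟩ ⟨i, by omega⟩ rfl
      have h2 := hk ⟨i + j, by omega⟩ ⟨i + (j - k), by omega⟩ (by simp; omega)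
      rw [hw ⟨i, by omega⟩, ← h1, h2]
      exact (hw ⟨i + (j - k), by omega⟩).symm
  have h : (correlationSet α n).encard ≤ ((n + 1) * periodBound n : ℕ) := by
    refine (Set.encard_le_encard hsub).trans
      ((encard_biUnion_le_mul _ _ (periodBound n) ?_).trans (by rw [Finset.card_range]))
    intro k _
    refine ((Set.encard_image_le _ _).trans (encard_periodSets_le _)).trans ?_
    exact_mod_cast periodBound_mono (Nat.sub_le n k)
  rw [← Set.Finite.cast_ncard_eq (Set.toFinite _)] at h
  exact_mod_cast h

lemma log_periodBound_le {n : ℕ} (hn : 0 < n) :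
    Real.log (periodBound n) ≤
      Real.log n ^ 2 / (2 * Real.log 2) + 3 / 2 * Real.log n + Real.log 2 := by
  have h2 : 0 < Real.log 2 := Real.log_pos one_lt_two
  induction n using Nat.strong_induction_on with
  | _ n ih =>
    rcases Nat.lt_or_ge n 2 with h | h
    · obtain rfl : n = 1 := by omega
      simp [periodBound]
    have hd : 0 < n / 2 := by omega
    have hF : (0 : ℝ) < periodBound (n / 2) := by exact_mod_cast periodBound_pos _
    have hn' : (0 : ℝ) < n := by exact_mod_cast hn
    have hy0 : 0 ≤ Real.log (n / 2 : ℕ) := Real.log_natCast_nonneg _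
    have hy : Real.log (n / 2 : ℕ) ≤ Real.log n - Real.log 2 := by
      rw [← Real.log_div hn'.ne' two_ne_zero]
      exact Real.log_le_log (by exact_mod_cast hd) Nat.cast_div_le
    rw [periodBound_of_pos hn]
    push_cast
    rw [Real.log_mul (by positivity) hF.ne', Real.log_mul two_ne_zero hn'.ne']
    have key := ih (n / 2) (by omega) hd
    generalize Real.log (n / 2 : ℕ) = y at *
    generalize Real.log n = x at *
    -- Halving `n` lowers the quadratic term by `x - log 2 / 2`, which pays for the factor `n`. The
    -- linear term drops by `3 / 2 * log 2`, which pays for the factor `2` and the leftover `log 2 /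
    -- 2`.
    have hsq : y ^ 2 / (2 * Real.log 2) ≤ (x - Real.log 2) ^ 2 / (2 * Real.log 2) := by gcongr
    have hex : (x - Real.log 2) ^ 2 / (2 * Real.log 2) =
        x ^ 2 / (2 * Real.log 2) - x + Real.log 2 / 2 := by
      field_simp
      ring
    linarith

/-! ### Nested words and their borders -/

/-- The length of `nestedWord y k`. -/
def nestedLen (y : ℕ → ℕ) : ℕ → ℕ
  | 0 => 1
  | k + 1 => 2 * nestedLen y k + y k

/-- The binary words given by `x₀ = 0` and `xₖ₊₁ = xₖ 1^(y k) xₖ`; only the first `nestedLen y k`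
letters of `nestedWord y k` matter. -/
def nestedWord (y : ℕ → ℕ) : ℕ → ℕ → Bool
  | 0, _ => false
  | k + 1, i =>
    if i < nestedLen y k then nestedWord y k i
    else if i < nestedLen y k + y k then true
    else nestedWord y k (i - (nestedLen y k + y k))

section Nested

variable {y : ℕ → ℕ} {k : ℕ}

lemma nestedLen_pos (y : ℕ → ℕ) (k : ℕ) : 0 < nestedLen y k := by
  induction k with
  | zero => simp [nestedLen]
  | succ k ih => rw [nestedLen]; omega

lemma nestedLen_strictMono (y : ℕ → ℕ) : StrictMono (nestedLen y) :=
  strictMono_nat_of_lt_succ fun k => by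
    have := nestedLen_pos y k
    rw [nestedLen]
    omega

lemma nestedLen_congr {y z : ℕ → ℕ} (h : ∀ i < k, y i = z i) :
    nestedLen y k = nestedLen z k := by
  induction k with
  | zero => rfl
  | succ k ih => rw [nestedLen, nestedLen, ih fun i hi => h i (by omega), h k (by omega)]

lemma two_pow_le_nestedLen (y : ℕ → ℕ) (k : ℕ) : 2 ^ k ≤ nestedLen y k := by
  induction k with
  | zero => simp [nestedLen]
  | succ k ih => rw [nestedLen, pow_succ]; omega

lemma nestedLen_le (h : ∀ i < k, y i ≤ 2 ^ (i + 1)) : nestedLen y k ≤ (k + 1) * 2 ^ k := by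
  induction k with
  | zero => simp [nestedLen]
  | succ k ih =>
    have h1 := ih fun i hi => h i (by omega)
    have h2 := h k (by omega)
    rw [nestedLen]
    calc 2 * nestedLen y k + y k ≤ 2 * ((k + 1) * 2 ^ k) + 2 ^ (k + 1) := by omega
      _ = (k + 1 + 1) * 2 ^ (k + 1) := by ring

lemma nestedWord_succ_of_lt {i : ℕ} (h : i < nestedLen y k) :
    nestedWord y (k + 1) i = nestedWord y k i := by
  rw [nestedWord, if_pos h]

lemma nestedWord_succ_mid {i : ℕ} (h : nestedLen y k ≤ i) (h' : i < nestedLen y k + y k) :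
    nestedWord y (k + 1) i = true := by
  rw [nestedWord, if_neg (by omega), if_pos h']

lemma nestedWord_succ_add (y : ℕ → ℕ) (k i : ℕ) :
    nestedWord y (k + 1) (i + (nestedLen y k + y k)) = nestedWord y k i := by
  have := nestedLen_pos y k
  rw [nestedWord, if_neg (by omega), if_neg (by omega), Nat.add_sub_cancel]

lemma nestedWord_zero_right (y : ℕ → ℕ) (k : ℕ) : nestedWord y k 0 = false := by
  induction k with
  | zero => rfl
  | succ k ih => rw [nestedWord_succ_of_lt (nestedLen_pos y k), ih]

lemma nestedWord_last (y : ℕ → ℕ) (k : ℕ) : nestedWord y k (nestedLen y k - 1) = false := by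
  induction k with
  | zero => rfl
  | succ k ih =>
    have := nestedLen_pos y k
    rw [← ih, ← nestedWord_succ_add y k (nestedLen y k - 1), nestedLen]
    congr 1
    omega

lemma exists_nestedWord_eq_false {r : ℕ} (hr : 0 < r) (h : ∀ j < k, y j < r) {s : ℕ}
    (hs : s + r ≤ nestedLen y k) : ∃ i, s ≤ i ∧ i < s + r ∧ nestedWord y k i = false := by
  induction k generalizing s with
  | zero => exact ⟨s, le_rfl, by omega, rfl⟩
  | succ k ih =>
    have hpos := nestedLen_pos y k
    have hyk := h k (by omega)
    replace ih := @ih (fun j hj => h j (by omega))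
    rw [nestedLen] at hs
    by_cases h1 : s + r ≤ nestedLen y k
    · obtain ⟨i, hi, hi', hw⟩ := ih h1
      exact ⟨i, hi, hi', by rw [nestedWord_succ_of_lt (by omega), hw]⟩
    by_cases h2 : s < nestedLen y k
    · exact ⟨nestedLen y k - 1, by omega, by omega, by
        rw [nestedWord_succ_of_lt (by omega), nestedWord_last]⟩
    by_cases h3 : s ≤ nestedLen y k + y k
    · refine ⟨0 + (nestedLen y k + y k), by omega, by omega, ?_⟩
      rw [nestedWord_succ_add, nestedWord_zero_right]
    · obtain ⟨i, hi, hi', hw⟩ := @ih (s - (nestedLen y k + y k)) (by omega)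
      exact ⟨i + (nestedLen y k + y k), by omega, by omega, by rw [nestedWord_succ_add, hw]⟩

/-- A smaller period `d` either moves the initial `0` into the middle block of ones, or copies that
block to the left, where it would cover the last `0` of `xₖ` or form too long a run of ones inside
`xₖ`. -/
lemma le_of_mem_periodSet_nestedWord (hy : 0 < y k) (h : ∀ j < k, y j < y k) {d : ℕ} (hd : 0 < d)
    (hper : d ∈ periodSet (nestedWord y (k + 1)) (nestedLen y (k + 1))) :
    nestedLen y k + y k ≤ d := by
  by_contra! hlt
  have hpos := nestedLen_pos y k
  rw [nestedLen] at hper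
  rcases le_or_gt (nestedLen y k) d with h1 | h1
  · have := hper 0 (by omega)
    rw [nestedWord_zero_right, zero_add, nestedWord_succ_mid h1 hlt] at this
    exact absurd this (by simp)
  have hrun : ∀ i, nestedLen y k - d ≤ i → i < nestedLen y k - d + y k →
      nestedWord y (k + 1) i = true := by
    intro i hi hi'
    rw [hper i (by omega)]
    exact nestedWord_succ_mid (by omega) (by omega)
  by_cases h2 : d ≤ y k
  · have := hrun (nestedLen y k - 1) (by omega) (by omega)
    rw [nestedWord_succ_of_lt (by omega), nestedWord_last] at this
    exact absurd this (by simp)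
  · obtain ⟨i, hi, hi', hw⟩ :=
      exists_nestedWord_eq_false hy h (s := nestedLen y k - d) (by omega)
    have := hrun i hi hi'
    rw [nestedWord_succ_of_lt (by omega), hw] at this
    exact absurd this (by simp)

lemma periodSet_congr {α : Type*} {v w : ℕ → α} {m : ℕ} (h : ∀ i < m, v i = w i) :
    periodSet v m = periodSet w m := by
  ext e
  refine forall_congr' fun i => forall_congr' fun hi => ?_
  rw [h i (by omega), h (i + e) hi]

/-- The proper nonempty borders of `nestedWord y k` are the shorter nested words. -/
lemma sub_mem_periodSet_nestedWord_iff (hy : ∀ j < k, 0 < y j) (h : ∀ i j, i < j → j < k → y i < y j)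
    {b : ℕ} (hb0 : 0 < b) (hb : b < nestedLen y k) :
    nestedLen y k - b ∈ periodSet (nestedWord y k) (nestedLen y k) ↔
      ∃ j < k, nestedLen y j = b := by
  induction k with
  | zero =>
    rw [nestedLen] at hb
    omega
  | succ k ih =>
    replace ih := ih (fun j hj => hy j (by omega)) (fun i j hij hj => h i j hij (by omega))
    rcases lt_or_ge (nestedLen y k) b with hlt | hle
    · constructor
      · intro hper
        have := le_of_mem_periodSet_nestedWord (hy k (by omega)) (fun j hj => h j k hj (by omega))
          (by omega) hper
        rw [nestedLen] at this hb
        omega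
      · rintro ⟨j, hj, rfl⟩
        have := (nestedLen_strictMono y).monotone (show j ≤ k by omega)
        omega
    · have hlen : nestedLen y (k + 1) = 2 * nestedLen y k + y k := rfl
      have hq : nestedLen y k + y k ∈ periodSet (nestedWord y (k + 1)) (nestedLen y (k + 1)) := by
        intro i hi
        rw [nestedWord_succ_add, nestedWord_succ_of_lt (by omega)]
      rw [mem_periodSet_iff_of_le hq (by omega),
        show nestedLen y (k + 1) - (nestedLen y k + y k) = nestedLen y k by omega,
        periodSet_congr fun i hi => nestedWord_succ_of_lt hi,
        show nestedLen y (k + 1) - b - (nestedLen y k + y k) = nestedLen y k - b by omega]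
      rcases hle.lt_or_eq with hlt | rfl
      · rw [ih hlt]
        constructor
        · rintro ⟨j, hj, rfl⟩
          exact ⟨j, by omega, rfl⟩
        · rintro ⟨j, hj, rfl⟩
          rw [(nestedLen_strictMono y).lt_iff_lt] at hlt
          exact ⟨j, hlt, rfl⟩
      · rw [Nat.sub_self]
        exact iff_of_true zero_mem_periodSet ⟨k, by omega, rfl⟩

end Nested

/-! ### Lower bound for the number of correlations -/

/-- The block lengths `2 ^ i + c i` for `i < k`, and `l` afterwards. -/
def blockLen {k : ℕ} (c : (i : Fin k) → Fin (2 ^ (i : ℕ))) (l i : ℕ) : ℕ :=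
  if h : i < k then 2 ^ i + c ⟨i, h⟩ else l

section BlockLen

variable {k n : ℕ} (c : (i : Fin k) → Fin (2 ^ (i : ℕ)))

/-- Block lengths such that the `(k + 1)`-st nested word has length `n`. -/
def fittedLen (n : ℕ) : ℕ → ℕ := blockLen c (n - 2 * nestedLen (blockLen c 0) k)

lemma blockLen_of_lt {l i : ℕ} (h : i < k) : blockLen c l i = 2 ^ i + c ⟨i, h⟩ := by
  rw [blockLen, dif_pos h]

lemma blockLen_lt {l i : ℕ} (h : i < k) : blockLen c l i < 2 ^ (i + 1) := by
  rw [blockLen_of_lt c h, pow_succ]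
  have := (c ⟨i, h⟩).2
  simp only at this
  omega

lemma fittedLen_self : fittedLen c n k = n - 2 * nestedLen (fittedLen c n) k := by
  have : nestedLen (fittedLen c n) k = nestedLen (blockLen c 0) k :=
    nestedLen_congr fun i hi => by rw [fittedLen, blockLen_of_lt c hi, blockLen_of_lt c hi]
  rw [this, fittedLen, blockLen, dif_neg (lt_irrefl k)]

variable (hn : 3 * ((k + 1) * 2 ^ k) ≤ n)
include hn

/-- Two copies of `xₖ` then leave a middle block at least as long as `xₖ`, hence of length at least
`2 ^ k` and longer than every earlier block. -/
lemma three_mul_nestedLen_le : 3 * nestedLen (fittedLen c n) k ≤ n := by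
  have := nestedLen_le (y := fittedLen c n) (k := k) fun i hi => (blockLen_lt c hi).le
  omega

lemma nestedLen_fittedLen : nestedLen (fittedLen c n) (k + 1) = n := by
  have := three_mul_nestedLen_le c hn
  rw [nestedLen, fittedLen_self]
  omega

lemma fittedLen_ge {j : ℕ} (hj : j < k + 1) : 2 ^ j ≤ fittedLen c n j := by
  rcases Nat.lt_succ_iff_lt_or_eq.1 hj with h | rfl
  · rw [fittedLen, blockLen_of_lt c h]
    omega
  · have := three_mul_nestedLen_le c hn
    have := two_pow_le_nestedLen (fittedLen c n) j
    rw [fittedLen_self]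
    omega

lemma fittedLen_lt {i j : ℕ} (hij : i < j) (hj : j < k + 1) :
    fittedLen c n i < fittedLen c n j :=
  (blockLen_lt c (by omega)).trans_le
    ((Nat.pow_le_pow_right two_pos hij).trans (fittedLen_ge c hn hj))

end BlockLen

lemma correlation_self_apply {α : Type*} {a b : α} (hab : a ≠ b) (w : ℕ → Bool) (n : ℕ)
    (e : Fin n) :
    correlation (fun i : Fin n => if w i then a else b) (fun i : Fin n => if w i then a else b) e
      = true ↔ (e : ℕ) ∈ periodSet w n := by
  have hinj : ∀ s t : Bool, (if s then a else b) = (if t then a else b) ↔ s = t := by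
    rintro (_ | _) (_ | _) <;> simp [hab, hab.symm]
  simp only [correlation, decide_eq_true_eq, hinj]
  constructor
  · intro h i hi
    exact (h ⟨i + e, hi⟩ ⟨i, by omega⟩ rfl).symm
  · intro h i j hij
    rw [hij, h j (by omega)]

theorem two_pow_le_numCorrelations (α : Type*) [Nontrivial α] {k n : ℕ}
    (hn : 3 * ((k + 1) * 2 ^ k) ≤ n) :
    2 ^ (∑ i ∈ Finset.range k, i) ≤ numCorrelations α n := by
  obtain ⟨a, b, hab⟩ := exists_pair_ne α
  let W : ((i : Fin k) → Fin (2 ^ (i : ℕ))) → Fin n → α := fun c i =>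
    if nestedWord (fittedLen c n) (k + 1) i then a else b
  let f : ((i : Fin k) → Fin (2 ^ (i : ℕ))) → Fin n → Bool := fun c => correlation (W c) (W c)
  have hmem : ∀ c (l : ℕ) (hl0 : 0 < l) (hl : l < n),
      f c ⟨n - l, by omega⟩ = true ↔ ∃ j < k + 1, nestedLen (fittedLen c n) j = l := by
    intro c l hl0 hl
    have h := sub_mem_periodSet_nestedWord_iff (y := fittedLen c n) (k := k + 1)
      (fun j hj => (Nat.two_pow_pos j).trans_le (fittedLen_ge c hn hj))
      (fun i j hij hj => fittedLen_lt c hn hij hj) hl0 (by rwa [nestedLen_fittedLen c hn])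
    rw [nestedLen_fittedLen c hn] at h
    rw [← h]
    exact correlation_self_apply hab _ n ⟨n - l, by omega⟩
  have hlt : ∀ c, ∀ j < k + 1, nestedLen (fittedLen c n) j < n := fun c j hj =>
    (nestedLen_strictMono _ hj).trans_eq (nestedLen_fittedLen c hn)
  have hsub : ∀ c c', f c = f c' →
      Set.range (fun j : Fin (k + 1) => nestedLen (fittedLen c n) j) ⊆
        Set.range (fun j : Fin (k + 1) => nestedLen (fittedLen c' n) j) := by
    rintro c c' hcc _ ⟨j, rfl⟩
    have h1 := (hmem c _ (nestedLen_pos _ j) (hlt c j j.2)).2 ⟨j, j.2, rfl⟩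
    rw [hcc] at h1
    obtain ⟨i, hi, h⟩ := (hmem c' _ (nestedLen_pos _ j) (hlt c j j.2)).1 h1
    exact ⟨⟨i, hi⟩, h⟩
  have hmono (c : (i : Fin k) → Fin (2 ^ (i : ℕ))) :
      StrictMono fun j : Fin (k + 1) => nestedLen (fittedLen c n) j :=
    (nestedLen_strictMono _).comp Fin.val_strictMono
  have hinj : Function.Injective f := by
    intro c c' hcc
    -- Equal correlations give equal sets of border lengths. Being increasing, the two length
    -- sequences agree, and `yᵢ` is recovered as `Lᵢ₊₁ - 2 Lᵢ`.
    have hlen := (StrictMono.range_inj (hmono c) (hmono c')).1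
      ((hsub c c' hcc).antisymm (hsub c' c hcc.symm))
    funext i
    have h0 := congrFun hlen ⟨i, by omega⟩
    have h1 := congrFun hlen ⟨i + 1, by omega⟩
    simp only [nestedLen] at h0 h1
    have h2 : fittedLen c n i = fittedLen c' n i := by omega
    rw [fittedLen, fittedLen, blockLen_of_lt c i.2, blockLen_of_lt c' i.2] at h2
    exact Fin.ext (by simpa using h2)
  have hcard : Nat.card ((i : Fin k) → Fin (2 ^ (i : ℕ))) = 2 ^ (∑ i ∈ Finset.range k, i) := by
    rw [Nat.card_eq_fintype_card, Fintype.card_pi]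
    simp only [Fintype.card_fin]
    rw [Fin.prod_univ_eq_prod_range (fun i => 2 ^ i) k, Finset.prod_pow_eq_pow_sum]
  rw [← hcard, ← Nat.card_range_of_injective hinj]
  refine Set.ncard_le_ncard ?_ (Set.toFinite _)
  rintro _ ⟨c, rfl⟩
  exact ⟨W c, W c, rfl⟩

/-! ### Asymptotics -/

lemma log_numCorrelations_le (α : Type*) [Nonempty α] {n : ℕ} (hn : 0 < n)
    (hpos : 0 < numCorrelations α n) :
    Real.log (numCorrelations α n) ≤
      Real.log n ^ 2 / (2 * Real.log 2) + 5 / 2 * Real.log n + 2 * Real.log 2 := by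
  have hF : (0 : ℝ) < periodBound n := by exact_mod_cast periodBound_pos n
  have hn' : (1 : ℝ) ≤ n := by exact_mod_cast hn
  have h1 : (numCorrelations α n : ℝ) ≤ (2 * n) * periodBound n := by
    refine (Nat.cast_le.2 (numCorrelations_le α n)).trans ?_
    push_cast
    gcongr
    linarith
  have h2 := Real.log_le_log (by exact_mod_cast hpos) h1
  rw [Real.log_mul (by positivity) hF.ne', Real.log_mul two_ne_zero (by positivity)] at h2
  linarith [log_periodBound_le hn]

/-- A lower bound, in terms of `x = log n`, for a depth `k` of nesting possible in length `n`. -/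
noncomputable def nestingDepth (x : ℝ) : ℝ :=
  x / Real.log 2 - 4 - Real.log (x / Real.log 2) / Real.log 2

lemma log_numCorrelations_ge (α : Type*) [Nontrivial α] {n : ℕ} (hn : 3 ≤ n)
    (hg : 1 ≤ nestingDepth (Real.log n)) :
    (nestingDepth (Real.log n) - 1) ^ 2 * (Real.log 2 / 2) ≤ Real.log (numCorrelations α n) := by
  have h2 : 0 < Real.log 2 := Real.log_pos one_lt_two
  set N := Nat.log 2 n with hN
  -- The depth will be `k = N - j`: then `2 ^ j > 4 * N ≥ 3 * (k + 1)`, so the words fit into length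
  -- `2 ^ N ≤ n`.
  set j := Nat.log 2 N + 3 with hj
  have hN1 : 1 ≤ N := Nat.log_pos one_lt_two (by omega)
  have hpowN : 2 ^ N ≤ n := Nat.pow_log_le_self 2 (by omega)
  have hlogn : Real.log n < (N + 1) * Real.log 2 := by
    have : (n : ℝ) < 2 ^ (N + 1) := by exact_mod_cast Nat.lt_pow_succ_log_self one_lt_two n
    have := Real.log_lt_log (by positivity) this
    rw [Real.log_pow] at this
    exact_mod_cast this
  have hNlog : N * Real.log 2 ≤ Real.log n := by
    rw [← Real.log_pow]
    exact Real.log_le_log (by positivity) (by exact_mod_cast hpowN)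
  have hjlog : (Nat.log 2 N : ℝ) * Real.log 2 ≤ Real.log (Real.log n / Real.log 2) := by
    rw [← Real.log_pow]
    refine Real.log_le_log (by positivity) ?_
    refine le_trans ?_ ((le_div_iff₀ h2).2 hNlog)
    exact_mod_cast Nat.pow_log_le_self 2 (by omega)
  have hk : nestingDepth (Real.log n) ≤ (N : ℝ) - j := by
    have e1 : Real.log n / Real.log 2 < N + 1 := (div_lt_iff₀ h2).2 hlogn
    have e2 := (le_div_iff₀ h2).2 hjlog
    rw [nestingDepth, hj]
    push_cast
    linarith
  have hjN : j ≤ N := by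
    have : (j : ℝ) ≤ N := by linarith
    exact_mod_cast this
  obtain ⟨k, hkN⟩ := Nat.exists_eq_add_of_le hjN
  have hk' : nestingDepth (Real.log n) ≤ k := by
    rw [hkN] at hk
    push_cast at hk
    linarith
  have hfit : 3 * ((k + 1) * 2 ^ k) ≤ n := by
    refine le_trans ?_ hpowN
    have hlt : N < 2 ^ (Nat.log 2 N + 1) := Nat.lt_pow_succ_log_self one_lt_two N
    have h4 : 2 ^ j = 4 * 2 ^ (Nat.log 2 N + 1) := by rw [hj]; ring
    rw [hkN, pow_add, ← mul_assoc]
    exact Nat.mul_le_mul_right _ (by omega)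
  have hδ := two_pow_le_numCorrelations α hfit
  have hδ' : ((2 : ℝ) ^ (∑ i ∈ Finset.range k, i)) ≤ numCorrelations α n := by exact_mod_cast hδ
  have hlog := Real.log_le_log (by positivity) hδ'
  rw [Real.log_pow] at hlog
  refine le_trans ?_ hlog
  have hk1 : 1 ≤ k := by
    have : (1 : ℝ) ≤ k := by linarith
    exact_mod_cast this
  have hsum : ((∑ i ∈ Finset.range k, i : ℕ) : ℝ) = k * (k - 1) / 2 := by
    have := Finset.sum_range_id_mul_two k
    have : ((∑ i ∈ Finset.range k, i : ℕ) : ℝ) * 2 = k * (k - 1) := by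
      rw [← Nat.cast_pred hk1]
      exact_mod_cast this
    linarith
  rw [hsum]
  have : (nestingDepth (Real.log n) - 1) ^ 2 ≤ k * (k - 1) := by nlinarith
  nlinarith

lemma tendsto_log_div_self : Filter.Tendsto (fun x : ℝ => Real.log x / x) Filter.atTop (nhds 0) :=
  Real.isLittleO_log_id_atTop.tendsto_div_nhds_zero

lemma tendsto_nestingDepth_div :
    Filter.Tendsto (fun x => (nestingDepth x - 1) / x) Filter.atTop (nhds (1 / Real.log 2)) := by
  have h2 : 0 < Real.log 2 := Real.log_pos one_lt_two
  have h1 : Filter.Tendsto (fun x : ℝ => Real.log (x / Real.log 2) / (x / Real.log 2))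
      Filter.atTop (nhds 0) :=
    tendsto_log_div_self.comp (Filter.tendsto_id.atTop_div_const h2)
  have h3 : Filter.Tendsto (fun x : ℝ => 5 / x) Filter.atTop (nhds 0) :=
    Filter.tendsto_id.const_div_atTop 5
  have h4 := ((tendsto_const_nhds (x := 1 / Real.log 2)).sub h3).sub
    (h1.mul_const (1 / Real.log 2 / Real.log 2))
  rw [zero_mul, sub_zero, sub_zero] at h4
  refine h4.congr' ?_
  filter_upwards [Filter.eventually_gt_atTop 0] with x hx
  rw [nestingDepth]
  field_simp
  ring

theorem mainTheorem3 (α : Type*) [Finite α] [Nontrivial α] :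
    Filter.Tendsto
      (fun n : ℕ => Real.log (numCorrelations α n : ℝ) / Real.log (n : ℝ) ^ 2)
      Filter.atTop (nhds (1 / (2 * Real.log 2))) := by
  have h2 : 0 < Real.log 2 := Real.log_pos one_lt_two
  have hlog : Filter.Tendsto (fun n : ℕ => Real.log n) Filter.atTop Filter.atTop :=
    Real.tendsto_log_atTop.comp tendsto_natCast_atTop_atTop
  have hlow : Filter.Tendsto (fun x => ((nestingDepth x - 1) / x) ^ 2 * (Real.log 2 / 2))
      Filter.atTop (nhds (1 / (2 * Real.log 2))) := by
    convert (tendsto_nestingDepth_div.pow 2).mul_const (Real.log 2 / 2) using 2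
    field_simp
  have hupp : Filter.Tendsto
      (fun x : ℝ => 1 / (2 * Real.log 2) + 5 / 2 / x + 2 * Real.log 2 / x / x)
      Filter.atTop (nhds (1 / (2 * Real.log 2))) := by
    have h (c : ℝ) : Filter.Tendsto (fun x : ℝ => c / x) Filter.atTop (nhds 0) :=
      Filter.tendsto_id.const_div_atTop c
    simpa using (tendsto_const_nhds (x := 1 / (2 * Real.log 2))).add (h (5 / 2)) |>.add
      ((h (2 * Real.log 2)).div_atTop Filter.tendsto_id)
  -- The lower estimate squares `nestingDepth x - 1`, so its sign must be settled first.
  have hdepth : ∀ᶠ x in Filter.atTop, 0 < (nestingDepth x - 1) / x :=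
    tendsto_nestingDepth_div.eventually (lt_mem_nhds (by positivity))
  refine tendsto_of_tendsto_of_tendsto_of_le_of_le' (hlow.comp hlog) (hupp.comp hlog) ?_ ?_
  · filter_upwards [hlog.eventually hdepth, hlog.eventually (Filter.eventually_gt_atTop 0),
      Filter.eventually_ge_atTop 3] with n hn hx hn3
    have hg : 1 ≤ nestingDepth (Real.log n) := by
      rw [div_pos_iff_of_pos_right hx] at hn
      linarith
    simp only [Function.comp_apply]
    rw [div_pow, div_mul_eq_mul_div]
    gcongr
    exact log_numCorrelations_ge α hn3 hg
  · filter_upwards [hlog.eventually (Filter.eventually_gt_atTop 0),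
      Filter.eventually_ge_atTop 3] with n hx hn3
    have hpos : 0 < numCorrelations α n :=
      (two_pow_le_numCorrelations (k := 0) α (by simpa using hn3)).trans_lt' (by simp)
    simp only [Function.comp_apply]
    rw [div_le_iff₀ (by positivity)]
    refine (log_numCorrelations_le α (by omega) hpos).trans_eq ?_
    field_simp
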